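/- Let $G$ be a finite group with center $Z(G)$ and derived subgroup $G'$. For a normal subgroup $N$ of $G$ with $1 < N < G$, the pair $(G,N)$ is called a Camina pair if every element $g \in G \setminus N$ is conjugate in $G$ to every element of the coset $gN$. Suppose that $(G,Z(G))$ is a Camina pair and that $Z(G) < G'$ (proper containment). Then $G$ is a $p$-group for some prime $p$ (necessarily unique), and for this prime $p$ either $|Z(G)|^2 \le |G:Z(G)|$ or $|Z(G)|\,p^4 \le |G:Z(G)|$. In particular, if $|G:Z(G)| \le p^8$, then $|Z(G)| \le |G:Z(G)|^{1/2}$. -/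

import Mathlib

/-- `IsCaminaPair N` says that `(G, N)` is a Camina pair: `N` is a normal subgroup of `G` with
`1 < N < G`, and every element `g` of `G` outside `N` is conjugate in `G` to every element of
the coset `gN`. -/
structure IsCaminaPair {G : Type*} [Group G] (N : Subgroup G) : Prop where
  normal : N.Normal
  bot_lt : ⊥ < N
  lt_top : N < ⊤
  isConj : ∀ g : G, g ∉ N → ∀ n ∈ N, IsConj g (g * n)

/-! Write Z for the center, |Z| = p^k and |G:Z| = p^n. For x outside Z let D(x) be the subgroup
commuting with x modulo Z. The Camina condition makes y ↦ [y, x] map D(x) onto Z, so the class of x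
has size |Z|·|G:D(x)|; as x lies in its own centralizer but not in Z, |G:D(x)| ≤ p^(n-k-1). Since Z
< G', some [x, y] is noncentral; D(x) ∩ D(y) centralizes it, so p^k ≤ p^(2(n-k-1)). An irreducible
character nontrivial on Z vanishes off Z, so n is even, and parity sharpens the bound. -/

theorem finite_restrictScalars (k A M : Type*) [CommSemiring k] [Semiring A] [Algebra k A]
    [Module.Finite k A] [AddCommMonoid M] [Module A M] [hM : Module.Finite A M] :
    Module.Finite k (RestrictScalars k A M) := by
  let _ := RestrictScalars.moduleOrig k A M
  have : Module.Finite A (RestrictScalars k A M) := hM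
  exact Module.Finite.trans A _

theorem ofModule_apply_ne_one {k G M : Type*} [Field k] [Group G] [AddCommGroup M]
    [Module (MonoidAlgebra k G) M] {z : G} {v : M}
    (hv : MonoidAlgebra.single z (1 : k) • v ≠ v) :
    Representation.ofModule (k := k) (G := G) M z ≠ 1 := by
  intro h
  let e := RestrictScalars.addEquiv k (MonoidAlgebra k G) M
  have h' := congrArg e (LinearMap.congr_fun h (e.symm v))
  simp [Representation.ofModule, e] at h'
  exact hv h'

-- The group algebra is semisimple: if z fixed every simple left ideal pointwise, it would fix their
-- sum, which contains 1.
universe u v in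
open MonoidAlgebra in
theorem exists_irreducible_apply_ne_one (k : Type u) [Field k] {G : Type v} [Group G] [Finite G]
    [NeZero (Nat.card G : k)] {z : G} (hz : z ∈ Subgroup.center G) (hz1 : z ≠ 1) :
    ∃ (V : Type (max u v)) (_ : AddCommGroup V) (_ : Module k V) (_ : FiniteDimensional k V)
      (ρ : Representation k G V), ρ.IsIrreducible ∧ ρ z ≠ 1 := by
  classical
  have hc : ∀ a : MonoidAlgebra k G, single z (1 : k) * a = a * single z 1 := by
    intro a
    induction a using MonoidAlgebra.induction_on with
    | of g => simp [Subgroup.mem_center_iff.mp hz g]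
    | add a b ha hb => rw [mul_add, add_mul, ha, hb]
    | smul c a ha => rw [mul_smul_comm, ha, smul_mul_assoc]
  obtain ⟨S, hS, v, hv⟩ : ∃ S : Submodule (MonoidAlgebra k G) (MonoidAlgebra k G),
      IsSimpleModule (MonoidAlgebra k G) S ∧ ∃ v : S, single z (1 : k) • v ≠ v := by
    by_contra! key
    have htop : (⊤ : Submodule (MonoidAlgebra k G) (MonoidAlgebra k G)) ≤
        LinearMap.ker (LinearMap.toSpanSingleton (MonoidAlgebra k G) (MonoidAlgebra k G)
          (single z (1 : k) - 1)) := by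
      rw [← IsSemisimpleModule.sSup_simples_eq_top]
      refine sSup_le fun S hS v hv => ?_
      have : single z (1 : k) * v = v := congrArg Subtype.val (key S hS ⟨v, hv⟩)
      simp [mul_sub, ← hc, this]
    have h1 := htop (Submodule.mem_top (x := 1))
    rw [LinearMap.mem_ker, LinearMap.toSpanSingleton_apply, one_smul, sub_eq_zero] at h1
    exact hz1 (MonoidAlgebra.of_injective (R := k) (h1.trans (map_one (MonoidAlgebra.of k G)).symm))
  exact ⟨RestrictScalars k (MonoidAlgebra k G) S, inferInstance, _,
    finite_restrictScalars k (MonoidAlgebra k G) S, Representation.ofModule S,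
    (Representation.isSimpleModule_iff_irreducible_ofModule S).mp hS, ofModule_apply_ne_one hv⟩

theorem apply_eq_smul_one_of_mem_center {k G V : Type*} [Field k] [IsAlgClosed k] [Group G]
    [AddCommGroup V] [Module k V] [FiniteDimensional k V] (ρ : Representation k G V)
    [ρ.IsIrreducible] {z : G} (hz : z ∈ Subgroup.center G) : ∃ c : k, ρ z = c • 1 := by
  obtain ⟨c, hc⟩ := (Representation.IsIrreducible.algebraMap_intertwiningMap_bijective_of_isAlgClosed
    (ρ := ρ)).2 ⟨ρ z, fun g => by
      change ρ z * ρ g = ρ g * ρ z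
      rw [← map_mul, ← map_mul, Subgroup.mem_center_iff.mp hz g]⟩
  refine ⟨c, ?_⟩
  ext v
  simpa using (DFunLike.congr_fun hc v).symm

/-- Off Z, χ(g) = χ(gz) = cχ(g) with c ≠ 1, so χ(g) = 0. On Z, χ(x)χ(x⁻¹) = χ(1)². Orthonormality
then gives |G| = |Z|χ(1)². -/
theorem isSquare_index_center {G : Type*} [Group G] [Finite G]
    (hZ : Subgroup.center G ≠ ⊥)
    (h : ∀ g : G, g ∉ Subgroup.center G → ∀ n ∈ Subgroup.center G, IsConj g (g * n)) :
    IsSquare (Subgroup.center G).index := by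
  classical
  have := Fintype.ofFinite G
  obtain ⟨z, hz, hz1⟩ := (Subgroup.center G).bot_or_exists_ne_one.resolve_left hZ
  obtain ⟨V, _, _, _, ρ, hρ, hρz⟩ := exists_irreducible_apply_ne_one ℂ hz hz1
  have hmul : ∀ g : G, ∀ x ∈ Subgroup.center G, ∀ c : ℂ, ρ x = c • 1 →
      ρ.character (g * x) = c * ρ.character g := by
    intro g x _ c hc
    simp [Representation.character, hc]
  have hvanish : ∀ g : G, g ∉ Subgroup.center G → ρ.character g = 0 := by
    intro g hg
    obtain ⟨c, hc⟩ := apply_eq_smul_one_of_mem_center ρ hz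
    obtain ⟨y, hy⟩ := isConj_iff.mp (h g hg z hz)
    have h1 := hmul g z hz c hc
    rw [← hy, Representation.char_conj] at h1
    by_contra h0
    have : c = 1 := by
      rw [eq_comm]; exact mul_right_cancel₀ h0 (by rw [one_mul]; exact h1)
    exact hρz (by rw [hc, this, one_smul])
  have hinv : Invertible (Nat.card G : ℂ) :=
    invertibleOfNonzero (by exact_mod_cast Nat.card_pos.ne')
  have hsum := Representation.char_orthonormal ρ ρ
  rw [if_pos ⟨.refl ρ⟩, ← Finset.sum_filter_add_sum_filter_not _ (· ∈ Subgroup.center G),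
    Finset.sum_eq_zero (s := Finset.univ.filter (¬ · ∈ Subgroup.center G)), add_zero,
    Finset.sum_congr (g := fun _ => (Module.finrank ℂ V : ℂ) ^ 2) rfl] at hsum
  · rw [Finset.sum_const, inv_mul_eq_one₀ (by exact_mod_cast Nat.card_pos.ne'), nsmul_eq_mul,
      ← Fintype.card_subtype, ← Nat.card_eq_fintype_card,
      ← (Subgroup.center G).card_mul_index] at hsum
    refine ⟨Module.finrank ℂ V, ?_⟩
    have h2 : Nat.card (Subgroup.center G) * (Subgroup.center G).index =
      Nat.card (Subgroup.center G) * Module.finrank ℂ V ^ 2 := by exact_mod_cast hsum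
    rw [← sq]
    exact Nat.eq_of_mul_eq_mul_left Nat.card_pos h2
  · intro x hx
    have hx := (Finset.mem_filter.mp hx).2
    obtain ⟨c, hc⟩ := apply_eq_smul_one_of_mem_center ρ hx
    have h1 := hmul 1 x hx c hc
    have h2 := hmul x⁻¹ x hx c hc
    rw [one_mul, Representation.char_one] at h1
    rw [inv_mul_cancel, Representation.char_one] at h2
    rw [h1, mul_right_comm, ← h2, sq]
  · intro x hx
    rw [hvanish x (Finset.mem_filter.mp hx).2, zero_mul]

namespace Subgroup

/-- The elements commuting with `x` modulo the center. -/
def centralizerModCenter {G : Type*} [Group G] (x : G) : Subgroup G :=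
  (centralizer {(x : G ⧸ center G)}).comap (QuotientGroup.mk' (center G))

variable {G : Type*} [Group G]

theorem mem_centralizerModCenter {x y : G} :
    y ∈ centralizerModCenter x ↔ y * x * y⁻¹ * x⁻¹ ∈ center G := by
  rw [centralizerModCenter, mem_comap, mem_centralizer_singleton_iff]
  rw [← QuotientGroup.eq_one_iff, QuotientGroup.mk_mul, QuotientGroup.mk_mul, QuotientGroup.mk_mul,
    QuotientGroup.mk_inv,
    QuotientGroup.mk_inv, mul_inv_eq_one, mul_inv_eq_iff_eq_mul, QuotientGroup.mk'_apply]

/-- The homomorphism `y ↦ [y, x]` into the center. -/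
def centralizerModCenterHom (x : G) : centralizerModCenter x →* center G where
  toFun y := ⟨y * x * (y : G)⁻¹ * x⁻¹, mem_centralizerModCenter.mp y.2⟩
  map_one' := by ext; simp
  map_mul' a b := by
    ext
    have h := mem_center_iff.mp (mem_centralizerModCenter.mp b.2) (a : G)
    have h' : (a : G) * (b * x * (b : G)⁻¹ * x⁻¹) * (x * (a : G)⁻¹ * x⁻¹) =
      b * x * (b : G)⁻¹ * x⁻¹ * a * (x * (a : G)⁻¹ * x⁻¹) := by rw [h]
    have h2 := mem_center_iff.mp (mem_centralizerModCenter.mp b.2) (a * x * (a : G)⁻¹ * x⁻¹ : G)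
    simp only [coe_mul, MulMemClass.mk_mul_mk, mul_inv_rev]
    rw [h2]
    simpa [mul_assoc] using h'

theorem ker_centralizerModCenterHom (x : G) :
    (centralizerModCenterHom x).ker = (centralizer {x}).subgroupOf (centralizerModCenter x) := by
  ext y
  rw [MonoidHom.mem_ker, mem_subgroupOf, mem_centralizer_singleton_iff, Subtype.ext_iff]
  change (y : G) * x * (y : G)⁻¹ * x⁻¹ = 1 ↔ _
  rw [mul_inv_eq_one, mul_inv_eq_iff_eq_mul]

theorem centralizer_le_centralizerModCenter (x : G) :
    centralizer {x} ≤ centralizerModCenter x := fun y hy => by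
  rw [mem_centralizer_singleton_iff] at hy
  rw [mem_centralizerModCenter, hy, mul_inv_cancel_right, mul_inv_cancel]
  exact one_mem _

-- Conjugation by such an element multiplies x and y by central factors, which cancel in the
-- commutator.
open scoped commutatorElement in
theorem centralizerModCenter_inf_le (x y : G) :
    centralizerModCenter x ⊓ centralizerModCenter y ≤ centralizer {⁅x, y⁆} := by
  rintro z ⟨hx, hy⟩
  have conj_eq : ∀ {w : G}, z ∈ centralizerModCenter w → ∃ c ∈ center G, z * w * z⁻¹ = c * w :=
    fun hw => ⟨_, mem_centralizerModCenter.mp hw, by group⟩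
  obtain ⟨a, ha, hax⟩ := conj_eq hx
  obtain ⟨b, hb, hby⟩ := conj_eq hy
  rw [mem_centralizer_singleton_iff, ← mul_inv_eq_iff_eq_mul]
  have h : z * ⁅x, y⁆ * z⁻¹ = ⁅z * x * z⁻¹, z * y * z⁻¹⁆ := by
    simp [commutatorElement_def, mul_assoc]
  rw [h, hax, hby, commutatorElement_def]
  have hb' := mem_center_iff.mp hb
  have ha' := mem_center_iff.mp ha
  calc a * x * (b * y) * (a * x)⁻¹ * (b * y)⁻¹
      = a * (x * b) * y * x⁻¹ * a⁻¹ * y⁻¹ * b⁻¹ := by group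
    _ = b * (a * (x * y * x⁻¹) * a⁻¹ * y⁻¹) * b⁻¹ := by
      rw [hb' x, ← mul_assoc a b x, ← ha' b]; group
    _ = a * (x * y * x⁻¹) * a⁻¹ * y⁻¹ := by
      rw [← hb', mul_inv_cancel_right]
    _ = x * y * x⁻¹ * y⁻¹ := by
      rw [← ha']; group

end Subgroup

namespace IsCaminaPair

open Subgroup
open scoped commutatorElement

variable {G : Type*} [Group G]

theorem index_centralizer (hG : IsCaminaPair (center G)) {x : G} (hx : x ∉ center G) :
    (centralizer {x}).index = Nat.card (center G) * (centralizerModCenter x).index := by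
  have hsurj : Function.Surjective (centralizerModCenterHom x) := by
    intro z
    obtain ⟨y, hy⟩ := isConj_iff.mp (hG.isConj x hx z z.2)
    have hyz : y * x * y⁻¹ * x⁻¹ = z := by
      rw [hy, mem_center_iff.mp z.2 x, mul_inv_cancel_right]
    exact ⟨⟨y, mem_centralizerModCenter.mpr (hyz ▸ z.2)⟩, Subtype.ext hyz⟩
  rw [← relIndex_mul_index (centralizer_le_centralizerModCenter x), relIndex,
    ← ker_centralizerModCenterHom, index_ker, MonoidHom.range_eq_top.mpr hsurj, card_top]

/-- Otherwise g would be conjugate to gz with z central of order p, whose order is p times that of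
g. -/
theorem mem_center_of_coprime [Finite G] (hG : IsCaminaPair (center G)) {p : ℕ} [Fact p.Prime]
    (hp : p ∣ Nat.card (center G)) {g : G} (hg : (orderOf g).Coprime p) : g ∈ center G := by
  by_contra hgZ
  obtain ⟨z, hz⟩ := exists_prime_orderOf_dvd_card' p hp
  obtain ⟨y, hy⟩ := isConj_iff.mp (hG.isConj g hgZ z z.2)
  have hcomm : Commute g (z : G) := mem_center_iff.mp z.2 g
  have hzo : orderOf (z : G) = p := by rw [orderOf_coe, hz]
  have h1 : orderOf (g * z) = orderOf g := by
    rw [← hy, ← MulAut.conj_apply]; exact MulEquiv.orderOf_eq _ g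
  rw [hcomm.orderOf_mul_eq_mul_orderOf_of_coprime (by rwa [hzo]), hzo] at h1
  have := (Fact.out : p.Prime).two_le
  have := orderOf_pos g
  nlinarith

theorem exists_isPGroup [Finite G] (hG : IsCaminaPair (center G)) :
    ∃ p : ℕ, p.Prime ∧ IsPGroup p G := by
  have hne : Nat.card (center G) ≠ 1 := fun h => hG.bot_lt.ne' (card_eq_one.mp h)
  obtain ⟨p, hp, hpZ⟩ := Nat.exists_prime_and_dvd hne
  have := Fact.mk hp
  have hle : ∀ s : ℕ, s.Prime → s ∣ Nat.card (center G) → ∀ r : ℕ, r.Prime → r ≠ s →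
      ∀ P : Sylow r G, (P : Subgroup G) ≤ center G := by
    intro s hs hsZ r hr hrs P g hg
    have := Fact.mk hs
    have := Fact.mk hr
    refine hG.mem_center_of_coprime hsZ ?_
    rw [← orderOf_mk g hg]
    exact P.2.orderOf_coprime ((Nat.coprime_primes hr hs).mpr hrs) _
  -- A second prime q would divide |Z| too; every Sylow subgroup would then be central, forcing G =
  -- Z.
  have hprime : ∀ q : ℕ, q.Prime → q ∣ Nat.card G → q = p := by
    intro q hq hqG
    by_contra hqp
    have := Fact.mk hq
    have hqZ : q ∣ Nat.card (center G) :=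
      (Sylow.dvd_card_of_dvd_card (default : Sylow q G) hqG).trans
        (card_dvd_of_le (hle p hp hpZ q hq hqp default))
    refine hG.lt_top.ne (index_eq_one.mp (Nat.eq_one_iff_not_exists_prime_dvd.mpr ?_))
    intro r hr hrZ
    have := Fact.mk hr
    have hrP : ((default : Sylow r G) : Subgroup G) ≤ center G := by
      by_cases h : r = p
      · exact hle q hq hqZ r hr (h ▸ Ne.symm hqp) _
      · exact hle p hp hpZ r hr h _
    exact (default : Sylow r G).not_dvd_index (hrZ.trans (index_dvd_of_le hrP))
  exact ⟨p, hp, .of_card (Nat.eq_prime_pow_of_unique_prime_dvd Nat.card_pos.ne' (hprime _))⟩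

theorem mul_card_mul_index_dvd [Finite G] (hG : IsCaminaPair (center G)) {p : ℕ} (hp : p.Prime)
    (hpG : IsPGroup p G) {x : G} (hx : x ∉ center G) :
    p * Nat.card (center G) * (centralizerModCenter x).index ∣ (center G).index := by
  have := Fact.mk hp
  have hle : center G ≤ centralizer {x} := center_le_centralizer _
  obtain ⟨n, hn⟩ := (hpG.to_subgroup (centralizer {x})).index ((center G).subgroupOf (centralizer {x}))
  rw [← relIndex_mul_index hle, hG.index_centralizer hx, ← mul_assoc]
  refine mul_dvd_mul_right (mul_dvd_mul_right ?_ _) _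
  rw [relIndex, hn]
  refine dvd_pow_self p ?_
  rintro rfl
  rw [pow_zero, index_eq_one, subgroupOf_eq_top] at hn
  exact hx (hn (mem_centralizer_singleton_iff.mpr rfl))

/-- If `|Z(G)| = p ^ k` and `|G : Z(G)| = p ^ n`, then `3 * k + 2 ≤ 2 * n`. -/
theorem three_mul_add_two_le [Finite G] (hG : IsCaminaPair (center G))
    (hlt : center G < commutator G) {p k n : ℕ} (hp : p.Prime) (hpG : IsPGroup p G)
    (hk : Nat.card (center G) = p ^ k) (hn : (center G).index = p ^ n) : 3 * k + 2 ≤ 2 * n := by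
  obtain ⟨x, y, hxy⟩ : ∃ x y : G, ⁅x, y⁆ ∉ center G := by
    by_contra! h
    exact hlt.not_ge (commutator_le.mpr fun x _ y _ => h x y)
  have hx : x ∉ center G := fun hx => hxy <| by
    rw [commutatorElement_eq_one_iff_mul_comm.mpr (mem_center_iff.mp hx y).symm]
    exact one_mem _
  have hy : y ∉ center G := fun hy => hxy <| by
    rw [commutatorElement_eq_one_iff_mul_comm.mpr (mem_center_iff.mp hy x)]
    exact one_mem _
  have hbound : ∀ z : G, z ∉ center G → p ^ (k + 1) * (centralizerModCenter z).index ≤ p ^ n := by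
    intro z hz
    rw [pow_succ', ← hk, ← hn]
    exact Nat.le_of_dvd (Nat.pos_of_ne_zero index_ne_zero_of_finite)
      (hG.mul_card_mul_index_dvd hp hpG hz)
  have h : p ^ k ≤ (centralizerModCenter x).index * (centralizerModCenter y).index := calc
    p ^ k ≤ (centralizer {⁅x, y⁆}).index := by
      rw [hG.index_centralizer hxy, hk]
      exact Nat.le_mul_of_pos_right _ (Nat.pos_of_ne_zero index_ne_zero_of_finite)
    _ ≤ (centralizerModCenter x ⊓ centralizerModCenter y).index :=
      index_antitone (centralizerModCenter_inf_le x y)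
    _ ≤ _ := index_inf_le
  rw [← Nat.pow_le_pow_iff_right hp.one_lt]
  calc p ^ (3 * k + 2) = p ^ (k + 1) * p ^ (k + 1) * p ^ k := by ring
    _ ≤ p ^ (k + 1) * p ^ (k + 1) *
        ((centralizerModCenter x).index * (centralizerModCenter y).index) := by gcongr
    _ = (p ^ (k + 1) * (centralizerModCenter x).index) *
        (p ^ (k + 1) * (centralizerModCenter y).index) := by ring
    _ ≤ p ^ n * p ^ n := Nat.mul_le_mul (hbound x hx) (hbound y hy)
    _ = p ^ (2 * n) := by ring

end IsCaminaPair

theorem theorem4 {G : Type*} [Group G] [Finite G]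
    (hG : IsCaminaPair (Subgroup.center G))
    (hlt : Subgroup.center G < commutator G) :
    ∃ p : ℕ, p.Prime ∧ IsPGroup p G ∧
      (Nat.card (Subgroup.center G) ^ 2 ≤ (Subgroup.center G).index ∨
        Nat.card (Subgroup.center G) * p ^ 4 ≤ (Subgroup.center G).index) ∧
      ((Subgroup.center G).index ≤ p ^ 8 →
        (Nat.card (Subgroup.center G) : ℝ) ≤ ((Subgroup.center G).index : ℝ) ^ (1 / 2 : ℝ)) := by
  obtain ⟨p, hp, hpG⟩ := hG.exists_isPGroup
  have := Fact.mk hp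
  obtain ⟨k, hk⟩ := IsPGroup.iff_card.mp (hpG.to_subgroup (Subgroup.center G))
  obtain ⟨n, hn⟩ := hpG.index (Subgroup.center G)
  have hkn := hG.three_mul_add_two_le hlt hp hpG hk hn
  have heven : Even n := by
    obtain ⟨d, hd⟩ := isSquare_index_center hG.bot_lt.ne' hG.isConj
    rw [hn] at hd
    obtain ⟨m, -, hm⟩ := (Nat.dvd_prime_pow hp).mp (Dvd.intro d hd.symm)
    rw [hm, ← pow_add] at hd
    exact ⟨m, Nat.pow_right_injective hp.two_le hd⟩
  have hcases : 2 * k ≤ n ∨ k + 4 ≤ n := by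
    obtain ⟨m, rfl⟩ := heven
    -- If 2k > n = 2m, then k ≥ m + 1 and 4m ≥ 3k + 2 give m ≥ 5, so k ≥ 6 and 2m ≥ (3k + 2)/2 ≥ k +
    -- 4.
    omega
  refine ⟨p, hp, hpG, ?_, ?_⟩
  · rw [hk, hn, ← pow_mul, ← pow_add]
    exact hcases.imp (fun h => Nat.pow_le_pow_right hp.pos (by omega))
      (Nat.pow_le_pow_right hp.pos)
  · intro h
    rw [hn, Nat.pow_le_pow_iff_right hp.one_lt] at h
    rw [← Real.sqrt_eq_rpow]
    refine Real.le_sqrt_of_sq_le ?_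
    rw [hk, hn]
    norm_cast
    rw [← pow_mul]
    -- For n ≤ 8, k + 4 ≤ n also yields 2k ≤ 2n - 8 ≤ n.
    exact Nat.pow_le_pow_right hp.pos (by omega)
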